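/- Let $M$ be a smooth (Hausdorff, finite-dimensional, boundaryless) real manifold and let $K\in\Omega^1(M;TM)$ be a smooth vector-valued $1$-form, i.e. a smooth bundle endomorphism $K:TM\to TM$. Let $D=\mathcal L_K=[\imath_K,\mathrm d]=\imath_K\circ \mathrm d-\mathrm d\circ\imath_K$ be the Lie derivative along $K$, a derivation of degree $1$ of the differential forms $\Omega(M)$, where $\imath_K\omega(Z_1,\dots,Z_p)=\sum_{j}\omega(Z_1,\dots,KZ_j,\dots,Z_p)$. A Lie algebroid structure on $TM$ consists of a smooth bundle map $q:TM\to TM$ (the anchor) and an $\mathbb R$-bilinear Lie bracket $[\![\cdot,\cdot]\!]$ on the smooth vector fields with $[\![X,fY]\!]=f[\![X,Y]\!]+(qX)(f)\,Y$. It is said to be induced by $D$ if $$(qX)(f)=Df(X),\qquad \alpha([\![X,Y]\!])=D(\alpha(Y))(X)-D(\alpha(X))(Y)-D\alpha(X,Y)$$ for all smooth functions $f$, smooth $1$-forms $\alpha$ and smooth vector fields $X,Y$. Then $D=\mathcal L_K$ induces a Lie algebroid structure on $TM$ with anchor $q=K$ and bracket the contracted bracket $$[X,Y]_K=[KX,Y]+[X,KY]-K[X,Y]$$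 if and only if the Nijenhuis torsion of $K$, $$T_K(X,Y)=[KX,KY]-K[KX,Y]-K[X,KY]+K^2[X,Y],$$ vanishes identically. Moreover, any Lie algebroid structure on $TM$ induced by $\mathcal L_K$ has anchor $K$ and bracket $[\cdot,\cdot]_K$. -/

import Mathlib

open scoped Manifold ContDiff Bundle
open VectorField

noncomputable section

section Algebra

variable {V : Type*} [AddCommGroup V] [Module ℝ V] [TopologicalSpace V] {p : ℕ}

/-- The insertion `i_k η` of an endomorphism `k` of `V` in an alternating `p`-form `η` on `V`:
`(i_k η)(v₁, …, v_p) = ∑ j, η(v₁, …, k v_j, …, v_p)`. On `0`-forms it vanishes. -/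
def insertEndomorphism (k : V →L[ℝ] V) (η : V [⋀^Fin p]→L[ℝ] ℝ) : V [⋀^Fin p]→L[ℝ] ℝ where
  toContinuousMultilinearMap := ∑ j : Fin p,
    η.toContinuousMultilinearMap.compContinuousLinearMap
      (Function.update (fun _ => ContinuousLinearMap.id ℝ V) j k)
  map_eq_zero_of_eq' := by
    intro v a b hv hab
    have key : ∀ j : Fin p,
        (fun i => (Function.update (fun _ => ContinuousLinearMap.id ℝ V) j k) i (v i)) =
          Function.update v j (k (v j)) := by
      intro j
      funext i
      by_cases h : i = j
      · subst h; simp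
      · simp [h]
    have hsum : ∀ j : Fin p, j ≠ a ∧ j ≠ b → η (Function.update v j (k (v j))) = 0 := by
      rintro j ⟨ha, hb⟩
      refine η.map_eq_zero_of_eq _ (i := a) (j := b) ?_ hab
      simp [ha.symm, hb.symm, hv]
    have hswap : η (Function.update v b (k (v b))) = - η (Function.update v a (k (v a))) := by
      rw [show η (Function.update v a (k (v a))) = η.toAlternatingMap (Function.update v a (k (v a)))
        from rfl, ← η.toAlternatingMap.map_swap _ hab]
      change η _ = η _
      congr 1
      funext i
      by_cases hia : i = a
      · subst hia; simp [hab, Ne.symm hab, hv]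
      · by_cases hib : i = b
        · subst hib; simp [hv]
        · simp [Equiv.swap_apply_of_ne_of_ne hia hib, hia, hib]
    change (∑ j : Fin p, η.toContinuousMultilinearMap.compContinuousLinearMap
      (Function.update (fun _ => ContinuousLinearMap.id ℝ V) j k)) v = 0
    rw [_root_.sum_apply]
    have h2 : ∀ j : Fin p, (η.toContinuousMultilinearMap.compContinuousLinearMap
        (Function.update (fun _ => ContinuousLinearMap.id ℝ V) j k)) v =
          η (Function.update v j (k (v j))) := by
      intro j
      rw [← key j]
      rfl
    rw [Finset.sum_congr rfl (fun j _ => h2 j),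
      Finset.sum_eq_add a b hab (fun j _ hj => hsum j hj) (by simp) (by simp), hswap]
    simp

theorem insertEndomorphism_apply (k : V →L[ℝ] V) (η : V [⋀^Fin p]→L[ℝ] ℝ) (v : Fin p → V) :
    insertEndomorphism k η v = ∑ j : Fin p, η (Function.update v j (k (v j))) := by
  change (∑ j : Fin p, η.toContinuousMultilinearMap.compContinuousLinearMap
      (Function.update (fun _ => ContinuousLinearMap.id ℝ V) j k)) v = _
  rw [_root_.sum_apply]
  refine Finset.sum_congr rfl fun j _ => ?_
  change η _ = η _
  congr 1
  funext i
  by_cases h : i = j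
  · subst h; simp
  · simp [h]

end Algebra

section Manifold

variable {E : Type*} [NormedAddCommGroup E] [NormedSpace ℝ E]
  {H : Type*} [TopologicalSpace H] (I : ModelWithCorners ℝ E H)
  (M : Type*) [TopologicalSpace M] [ChartedSpace H M]

/-- A (not necessarily smooth) differential `p`-form on `M`. -/
abbrev DiffForm (p : ℕ) : Type _ := (x : M) → (TangentSpace I x) [⋀^Fin p]→L[ℝ] ℝ

variable {I M}

/-- The expression of a `p`-form in the preferred chart around `x₀`, that is its pullback by the
inverse of that chart, a `p`-form on (a subset of) the model space `E`. -/
def DiffForm.inChart {p : ℕ} (η : DiffForm I M p) (x₀ : M) : E → E [⋀^Fin p]→L[ℝ] ℝ :=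
  fun y => (η ((extChartAt I x₀).symm y)).compContinuousLinearMap
    (mfderivWithin 𝓘(ℝ, E) I (extChartAt I x₀).symm (Set.range I) y)

/-- A `p`-form is smooth if its expressions in the charts are smooth. -/
def DiffForm.IsSmooth {p : ℕ} (η : DiffForm I M p) : Prop :=
  ∀ x₀ : M, ContDiffOn ℝ ∞ (η.inChart x₀) (extChartAt I x₀).target

/-- The exterior derivative `d`: computed in the preferred chart at each point, and pulled back
to the manifold. -/
def DiffForm.extDeriv {p : ℕ} (η : DiffForm I M p) : DiffForm I M (p + 1) :=
  fun x => (extDerivWithin (η.inChart x) (Set.range I) (extChartAt I x x)).compContinuousLinearMap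
    (mfderiv I 𝓘(ℝ, E) (extChartAt I x) x)

/-- A function on `M`, seen as a `0`-form. -/
def DiffForm.ofFun (f : M → ℝ) : DiffForm I M 0 :=
  fun x => ContinuousAlternatingMap.constOfIsEmpty ℝ (TangentSpace I x) (Fin 0) (f x)

/-- The insertion `i_K` of a vector-valued `1`-form `K` (an endomorphism of `TM`) in `p`-forms. -/
def DiffForm.insertion (K : (x : M) → TangentSpace I x →L[ℝ] TangentSpace I x) {p : ℕ}
    (η : DiffForm I M p) : DiffForm I M p :=
  fun x => insertEndomorphism (K x) (η x)

/-- The Lie derivative `𝓛_K = [i_K, d] = i_K ∘ d - d ∘ i_K` along a vector-valued `1`-form `K`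
(so that `i_K` has degree `0`); it is an operator of degree `1` on differential forms. -/
def DiffForm.lieDeriv (K : (x : M) → TangentSpace I x →L[ℝ] TangentSpace I x) (p : ℕ)
    (η : DiffForm I M p) : DiffForm I M (p + 1) :=
  DiffForm.insertion K η.extDeriv - (DiffForm.insertion K η).extDeriv

variable (I) in
/-- The contracted bracket `[X, Y]_K = [KX, Y] + [X, KY] - K[X, Y]`. -/
def contractedBracket (K : (x : M) → TangentSpace I x →L[ℝ] TangentSpace I x)
    (X Y : (x : M) → TangentSpace I x) : (x : M) → TangentSpace I x :=
  fun x => mlieBracket I (fun y => K y (X y)) Y x + mlieBracket I X (fun y => K y (Y y)) x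
    - K x (mlieBracket I X Y x)

variable (I) in
/-- The Nijenhuis torsion `T_K(X, Y) = [KX, KY] - K[KX, Y] - K[X, KY] + K²[X, Y]`. -/
def nijenhuisTorsion (K : (x : M) → TangentSpace I x →L[ℝ] TangentSpace I x)
    (X Y : (x : M) → TangentSpace I x) : (x : M) → TangentSpace I x :=
  fun x => mlieBracket I (fun y => K y (X y)) (fun y => K y (Y y)) x
    - K x (mlieBracket I (fun y => K y (X y)) Y x) - K x (mlieBracket I X (fun y => K y (Y y)) x)
    + K x (K x (mlieBracket I X Y x))

variable (I) in
/-- The derivative `v(f)` of a function `f` on `M` along a tangent vector `v` at `x`. -/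
def dirDeriv (f : M → ℝ) (x : M) (v : TangentSpace I x) : ℝ :=
  mfderiv I 𝓘(ℝ, ℝ) f x v

section Algebroid

variable (F : Type*) [NormedAddCommGroup F] [NormedSpace ℝ F]
  (V : M → Type*) [TopologicalSpace (Bundle.TotalSpace F V)]
  [∀ x, AddCommGroup (V x)] [∀ x, Module ℝ (V x)] [∀ x, TopologicalSpace (V x)]
  [FiberBundle F V] [VectorBundle ℝ F V]

variable {F V} in
/-- The product `f A` of a smooth section `A` of a vector bundle by a smooth function `f`. -/
def smulSection (f : C^∞⟮I, M; 𝓘(ℝ, ℝ), ℝ⟯) (A : Cₛ^∞⟮I; F, V⟯) : Cₛ^∞⟮I; F, V⟯ :=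
  ⟨fun x => f x • A x, f.contMDiff.smul_section A.contMDiff⟩

variable (I) in
/-- A Lie algebroid structure on a vector bundle `V → M`: an anchor (a smooth bundle map
`V → TM`) and a Lie bracket on the smooth sections of `V` satisfying the Leibniz rule
`[A, f B] = f [A, B] + (anchor A)(f) B`. -/
structure LieAlgebroid [IsManifold I ∞ M] where
  /-- the anchor -/
  anchor : Cₛ^∞⟮I; F →L[ℝ] E, fun x : M => V x →L[ℝ] TangentSpace I x⟯
  /-- the bracket of sections, an `ℝ`-bilinear map -/
  bracket : Cₛ^∞⟮I; F, V⟯ →ₗ[ℝ] Cₛ^∞⟮I; F, V⟯ →ₗ[ℝ] Cₛ^∞⟮I; F, V⟯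
  bracket_self : ∀ A, bracket A A = 0
  jacobi : ∀ A B C,
    bracket A (bracket B C) + bracket B (bracket C A) + bracket C (bracket A B) = 0
  leibniz : ∀ (f : C^∞⟮I, M; 𝓘(ℝ, ℝ), ℝ⟯) (A B) (x : M),
    bracket A (smulSection f B) x =
      f x • bracket A B x + dirDeriv I f x (anchor x (A x)) • B x

end Algebroid

/-- A Lie algebroid structure on `TM`, with anchor `q` and bracket `⟦·,·⟧`, is induced by an
operator `D` of degree `1` on differential forms if
`q(X)(f) = Df(X)` and `α(⟦X, Y⟧) = D(α(Y))(X) - D(α(X))(Y) - Dα(X, Y)`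
for all smooth functions `f`, smooth `1`-forms `α` and smooth vector fields `X`, `Y`. -/
structure LieAlgebroid.IsInducedBy [IsManifold I ∞ M]
    (A : LieAlgebroid I E (fun x : M => TangentSpace I x))
    (D : (p : ℕ) → DiffForm I M p → DiffForm I M (p + 1)) : Prop where
  anchor_eq : ∀ (f : C^∞⟮I, M; 𝓘(ℝ, ℝ), ℝ⟯)
    (X : Cₛ^∞⟮I; E, fun x : M => TangentSpace I x⟯) (x : M),
    dirDeriv I f x (A.anchor x (X x)) = D 0 (DiffForm.ofFun f) x ![X x]
  bracket_eq : ∀ α : DiffForm I M 1, α.IsSmooth →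
    ∀ (X Y : Cₛ^∞⟮I; E, fun x : M => TangentSpace I x⟯) (x : M),
    α x ![A.bracket X Y x] =
      D 0 (DiffForm.ofFun fun y => α y ![Y y]) x ![X x]
      - D 0 (DiffForm.ofFun fun y => α y ![X y]) x ![Y x]
      - D 1 α x ![X x, Y x]

end Manifold

end

/-!
Cartan's formula for the exterior derivative of a `1`-form turns the two conditions on a Lie
algebroid induced by `𝓛_K` into `(qX)(f) = (KX)(f)` and `α(⟦X, Y⟧) = α([X, Y]_K)`. As the
differentials of global functions separate tangent vectors, this forces `q = K` and
`⟦·,·⟧ = [·,·]_K`.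

The anchor of any Lie algebroid is a morphism of brackets: expand the Jacobi identity for `A`, `B`
and `f C` with the Leibniz rule. For the anchor `K` and the bracket `[·,·]_K` this says that
`K[X, Y]_K = [KX, KY]`, that is `T_K = 0`. Conversely, if `T_K = 0`, the Jacobi identity of
`[·,·]_K` is a combination of the Jacobi identities of `[·,·]` for the triples whose entries are
`X` or `KX`, `Y` or `KY`, and `Z` or `KZ`.
-/

noncomputable section

open Set Filter
open scoped Topology

section ContractedLie

variable {R L : Type*} [CommRing R] [LieRing L] [LieAlgebra R L]

/-- The contraction `[X, Y]_K = [KX, Y] + [X, KY] - K[X, Y]` of the bracket of a Lie algebra by a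
linear endomorphism `K`: the algebraic model of `contractedBracket`. -/
def contractedLie (K : L →ₗ[R] L) : L →ₗ[R] L →ₗ[R] L :=
  LinearMap.mk₂ R (fun X Y => ⁅K X, Y⁆ + ⁅X, K Y⁆ - K ⁅X, Y⁆)
    (fun X₁ X₂ Y => by simp only [map_add, add_lie]; abel)
    (fun c X Y => by simp only [map_smul, smul_lie, smul_add, smul_sub])
    (fun X Y₁ Y₂ => by simp only [map_add, lie_add]; abel)
    (fun c X Y => by simp only [map_smul, lie_smul, smul_add, smul_sub])

theorem contractedLie_apply (K : L →ₗ[R] L) (X Y : L) :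
    contractedLie K X Y = ⁅K X, Y⁆ + ⁅X, K Y⁆ - K ⁅X, Y⁆ :=
  rfl

theorem contractedLie_self (K : L →ₗ[R] L) (X : L) : contractedLie K X X = 0 := by
  rw [contractedLie_apply, lie_self, map_zero, sub_zero, ← lie_skew X (K X), add_neg_cancel]

theorem contractedLie_contractedLie {K : L →ₗ[R] L}
    (hK : ∀ X Y, K (contractedLie K X Y) = ⁅K X, K Y⁆) (X Y Z : L) :
    contractedLie K X (contractedLie K Y Z) =
      ⁅K X, ⁅K Y, Z⁆⁆ + ⁅K X, ⁅Y, K Z⁆⁆ + ⁅X, ⁅K Y, K Z⁆⁆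
        - K (⁅K X, ⁅Y, Z⁆⁆ + ⁅X, ⁅K Y, Z⁆⁆ + ⁅X, ⁅Y, K Z⁆⁆) + K (K ⁅X, ⁅Y, Z⁆⁆) := by
  have hT := hK X ⁅Y, Z⁆
  rw [contractedLie_apply, map_sub, map_add] at hT
  rw [contractedLie_apply, hK, contractedLie_apply K Y Z]
  simp only [lie_add, lie_sub, map_add, map_sub, ← hT]
  abel

/-- The terms of the Jacobi sum are the images under `1`, `-K` and `K²` of the Jacobi sums of
triples with respectively two, one and no entries replaced by their images under `K`. -/
theorem contractedLie_jacobi {K : L →ₗ[R] L}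
    (hK : ∀ X Y, K (contractedLie K X Y) = ⁅K X, K Y⁆) (X Y Z : L) :
    contractedLie K X (contractedLie K Y Z) + contractedLie K Y (contractedLie K Z X)
      + contractedLie K Z (contractedLie K X Y) = 0 := by
  have hK₁ := congrArg K (lie_jacobi (K X) Y Z)
  have hK₂ := congrArg K (lie_jacobi X (K Y) Z)
  have hK₃ := congrArg K (lie_jacobi X Y (K Z))
  have hKK := congrArg K (congrArg K (lie_jacobi X Y Z))
  simp only [map_add, map_zero] at hK₁ hK₂ hK₃ hKK
  simp only [contractedLie_contractedLie hK, map_add]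
  linear_combination (norm := abel) lie_jacobi (K X) (K Y) Z + lie_jacobi X (K Y) (K Z)
    + lie_jacobi (K X) Y (K Z) - hK₁ - hK₂ - hK₃ + hKK

end ContractedLie

variable {E : Type*} [NormedAddCommGroup E] [NormedSpace ℝ E]
  {H : Type*} [TopologicalSpace H] {I : ModelWithCorners ℝ E H}
  {M : Type*} [TopologicalSpace M] [ChartedSpace H M]

section Sections

variable {F : Type*} [NormedAddCommGroup F] [NormedSpace ℝ F]
  {V : M → Type*} [TopologicalSpace (Bundle.TotalSpace F V)]
  [∀ x, AddCommGroup (V x)] [∀ x, Module ℝ (V x)] [∀ x, TopologicalSpace (V x)]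
  [FiberBundle F V] [VectorBundle ℝ F V]
  {F' : Type*} [NormedAddCommGroup F'] [NormedSpace ℝ F']
  {V' : M → Type*} [TopologicalSpace (Bundle.TotalSpace F' V')]
  [∀ x, AddCommGroup (V' x)] [∀ x, Module ℝ (V' x)] [∀ x, TopologicalSpace (V' x)]
  [FiberBundle F' V'] [VectorBundle ℝ F' V']

theorem exists_contMDiffSection_apply_eq [FiniteDimensional ℝ E] [T2Space M] [IsManifold I ∞ M]
    [ContMDiffVectorBundle ∞ F V I] {x : M} (v : V x) : ∃ A : Cₛ^∞⟮I; F, V⟯, A x = v := by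
  obtain ⟨s, hs, hsv⟩ := FiberBundle.exists_contMDiffOn_extend I F (k := ∞) v
  obtain ⟨f, -, hf⟩ := (SmoothBumpFunction.nhds_basis_tsupport (I := I) x).mem_iff.1
    (interior_mem_nhds.2 hs)
  have hfv : ContMDiff I (I.prod 𝓘(ℝ, F)) ∞
      (fun y => Bundle.TotalSpace.mk' F y (f y • FiberBundle.extend F v y)) :=
    ContMDiffOn.smul_section_of_tsupport f.contMDiff.contMDiffOn isOpen_interior hf
      (hsv.mono interior_subset)
  exact ⟨⟨_, hfv⟩, by simp⟩

theorem smulSection_add (f : C^∞⟮I, M; 𝓘(ℝ, ℝ), ℝ⟯) (A B : Cₛ^∞⟮I; F, V⟯) :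
    smulSection f (A + B) = smulSection f A + smulSection f B := by
  ext x
  exact smul_add _ _ _

theorem smulSection_sub (f : C^∞⟮I, M; 𝓘(ℝ, ℝ), ℝ⟯) (A B : Cₛ^∞⟮I; F, V⟯) :
    smulSection f (A - B) = smulSection f A - smulSection f B := by
  ext x
  exact smul_sub _ _ _

/-- The action of a smooth bundle map on smooth sections. -/
def mapSection [∀ x, IsTopologicalAddGroup (V' x)] [∀ x, ContinuousSMul ℝ (V' x)]
    (φ : Cₛ^∞⟮I; F →L[ℝ] F', fun x : M => V x →L[ℝ] V' x⟯) :
    Cₛ^∞⟮I; F, V⟯ →ₗ[ℝ] Cₛ^∞⟮I; F', V'⟯ where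
  toFun A := ⟨fun x => φ x (A x), φ.contMDiff.clm_bundle_apply A.contMDiff⟩
  map_add' A B := by
    ext x
    exact map_add (φ x) _ _
  map_smul' c A := by
    ext x
    exact map_smul (φ x) _ _

theorem mapSection_smulSection [∀ x, IsTopologicalAddGroup (V' x)] [∀ x, ContinuousSMul ℝ (V' x)]
    (φ : Cₛ^∞⟮I; F →L[ℝ] F', fun x : M => V x →L[ℝ] V' x⟯) (f : C^∞⟮I, M; 𝓘(ℝ, ℝ), ℝ⟯)
    (A : Cₛ^∞⟮I; F, V⟯) : mapSection φ (smulSection f A) = smulSection f (mapSection φ A) := by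
  ext x
  exact map_smul (φ x) _ _

theorem subsingleton_section_of_subsingleton_fiber [Subsingleton F] :
    Subsingleton Cₛ^∞⟮I; F, V⟯ where
  allEq A B := by
    ext x
    have e := (trivializationAt F V x).continuousLinearEquivAt ℝ x
      (FiberBundle.mem_baseSet_trivializationAt' x)
    exact e.injective (Subsingleton.elim _ _)

end Sections

section VectorFields

variable (I M) in
/-- The smooth vector fields on `M`. -/
abbrev SmoothVectorField [IsManifold I 1 M] : Type _ :=
  Cₛ^∞⟮I; E, fun x : M => TangentSpace I x⟯

variable (I M) in
/-- The smooth vector-valued `1`-forms `K ∈ Ω¹(M; TM)`, encoded as endomorphisms of `TM`. -/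
abbrev SmoothEndomorphism [IsManifold I 1 M] : Type _ :=
  Cₛ^∞⟮I; E →L[ℝ] E, fun x : M => TangentSpace I x →L[ℝ] TangentSpace I x⟯

theorem exists_dirDeriv_ne_zero [FiniteDimensional ℝ E] [T2Space M] [IsManifold I ∞ M] {x : M}
    {v : TangentSpace I x} (hv : v ≠ 0) :
    ∃ f : C^∞⟮I, M; 𝓘(ℝ, ℝ), ℝ⟯, dirDeriv I f x v ≠ 0 := by
  obtain ⟨ℓ, hℓ⟩ : ∃ ℓ : E →L[ℝ] ℝ, ℓ v ≠ 0 := SeparatingDual.exists_ne_zero (R := ℝ) hv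
  obtain ⟨b⟩ : Nonempty (SmoothBumpFunction I x) := inferInstance
  have hφ : ContMDiffOn I 𝓘(ℝ, ℝ) ∞ (ℓ ∘ extChartAt I x) (chartAt H x).source :=
    ℓ.contMDiff.comp_contMDiffOn contMDiffOn_extChartAt
  refine ⟨⟨fun y => b y • ℓ (extChartAt I x y), b.contMDiff_smul hφ⟩, ?_⟩
  have heq : (fun y => b y • ℓ (extChartAt I x y)) =ᶠ[𝓝 x] ℓ ∘ extChartAt I x := by
    filter_upwards [b.eventuallyEq_one] with y hy
    simp [hy]
  have : dirDeriv I (fun y => b y • ℓ (extChartAt I x y)) x v = ℓ v := by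
    rw [dirDeriv, heq.mfderiv_eq, mfderiv_comp x ℓ.differentiableAt.mdifferentiableAt
      (mdifferentiableAt_extChartAt (mem_chart_source H x)), ℓ.mfderiv_eq, mfderiv_extChartAt_self]
    rfl
  exact this.trans_ne hℓ

theorem eq_of_forall_dirDeriv_eq [FiniteDimensional ℝ E] [T2Space M] [IsManifold I ∞ M] {x : M}
    {v w : TangentSpace I x}
    (h : ∀ f : C^∞⟮I, M; 𝓘(ℝ, ℝ), ℝ⟯, dirDeriv I f x v = dirDeriv I f x w) : v = w := by
  by_contra hne
  obtain ⟨f, hf⟩ := exists_dirDeriv_ne_zero (I := I) (sub_ne_zero.2 hne)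
  exact hf ((map_sub (mfderiv I 𝓘(ℝ, ℝ) f x) v w).trans (sub_eq_zero.2 (h f)))

variable [IsManifold I ∞ M]

/-- The derivative `X(f)` of a smooth function along a smooth vector field, as a smooth
function. -/
def derivAlong (X : SmoothVectorField I M) (f : C^∞⟮I, M; 𝓘(ℝ, ℝ), ℝ⟯) :
    C^∞⟮I, M; 𝓘(ℝ, ℝ), ℝ⟯ :=
  ⟨fun x => dirDeriv I f x (X x), by
    have hf : ContMDiff I (𝓘(ℝ, ℝ).tangent) ∞ fun x => tangentMap I 𝓘(ℝ, ℝ) f ⟨x, X x⟩ :=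
      (f.contMDiff.contMDiff_tangentMap (by simp)).comp X.contMDiff
    exact (contMDiff_snd_tangentBundle_modelSpace ℝ 𝓘(ℝ, ℝ)).comp hf⟩

namespace SmoothVectorField

theorem ext_derivAlong [FiniteDimensional ℝ E] [T2Space M] {X Y : SmoothVectorField I M}
    (h : ∀ f, derivAlong X f = derivAlong Y f) : X = Y := by
  ext x
  exact eq_of_forall_dirDeriv_eq fun f => congrArg (fun g => g x) (h f)

variable [CompleteSpace E]

instance instBracket : Bracket (SmoothVectorField I M) (SmoothVectorField I M) where
  bracket X Y := ⟨mlieBracket I X Y, by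
    have : IsManifold I ((∞ : ℕ∞ω) + 1) M := .of_le (n := ∞) (by simp)
    have : IsManifold I (minSmoothness ℝ 2) M := .of_le (n := ∞) (by simpa using ENat.LEInfty.out)
    exact ContDiff.mlieBracket_vectorField (m := ⊤) (n := ⊤) X.contMDiff Y.contMDiff (by simp)⟩

instance instLieRing : LieRing (SmoothVectorField I M) where
  add_lie X Y Z := by
    ext x
    exact mlieBracket_add_left X.mdifferentiableAt Y.mdifferentiableAt
  lie_add X Y Z := by
    ext x
    exact mlieBracket_add_right Y.mdifferentiableAt Z.mdifferentiableAt
  lie_self X := by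
    ext x
    exact congrFun mlieBracket_self x
  leibniz_lie X Y Z := by
    have : IsManifold I (minSmoothness ℝ 3) M := .of_le (n := ∞) (by simpa using ENat.LEInfty.out)
    have h2 : minSmoothness ℝ 2 ≤ ∞ := by simpa using ENat.LEInfty.out
    ext x
    exact leibniz_identity_mlieBracket_apply ((X.contMDiff x).of_le h2) ((Y.contMDiff x).of_le h2)
      ((Z.contMDiff x).of_le h2)

instance instLieAlgebra : LieAlgebra ℝ (SmoothVectorField I M) where
  lie_smul c X Y := by
    ext x
    exact mlieBracket_const_smul_right Y.mdifferentiableAt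

theorem lie_smulSection (X : SmoothVectorField I M) (f : C^∞⟮I, M; 𝓘(ℝ, ℝ), ℝ⟯)
    (Y : SmoothVectorField I M) :
    ⁅X, smulSection f Y⁆ = smulSection f ⁅X, Y⁆ + smulSection (derivAlong X f) Y := by
  ext x
  exact (mlieBracket_smul_right f.mdifferentiableAt Y.mdifferentiableAt).trans
    (add_comm _ _)

end SmoothVectorField

end VectorFields

section Anchor

variable [IsManifold I ∞ M] {F : Type*} [NormedAddCommGroup F] [NormedSpace ℝ F]
  {V : M → Type*} [TopologicalSpace (Bundle.TotalSpace F V)]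
  [∀ x, AddCommGroup (V x)] [∀ x, Module ℝ (V x)] [∀ x, TopologicalSpace (V x)]
  [FiberBundle F V] [VectorBundle ℝ F V]

/-- Expand both sides of `[A, [B, f C]] = [[A, B], f C] + [B, [A, f C]]`: everything cancels except
the terms containing an undifferentiated `C`. -/
theorem smulSection_derivAlong_of_leibniz
    {b : Cₛ^∞⟮I; F, V⟯ → Cₛ^∞⟮I; F, V⟯ →ₗ[ℝ] Cₛ^∞⟮I; F, V⟯}
    {ρ : Cₛ^∞⟮I; F, V⟯ → SmoothVectorField I M}
    (b_jacobi : ∀ A B C, b A (b B C) = b (b A B) C + b B (b A C))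
    (b_smul : ∀ A f B, b A (smulSection f B) =
      smulSection f (b A B) + smulSection (derivAlong (ρ A) f) B)
    (A B C : Cₛ^∞⟮I; F, V⟯) (f : C^∞⟮I, M; 𝓘(ℝ, ℝ), ℝ⟯) :
    smulSection (derivAlong (ρ (b A B)) f) C =
      smulSection (derivAlong (ρ A) (derivAlong (ρ B) f)) C
        - smulSection (derivAlong (ρ B) (derivAlong (ρ A) f)) C := by
  have h := b_jacobi A B (smulSection f C)
  simp only [b_smul, map_add, b_jacobi A B C, smulSection_add] at h
  rw [eq_sub_iff_add_eq, ← sub_eq_zero]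
  rw [← sub_eq_zero] at h
  rw [← neg_eq_zero, ← h]
  abel

theorem derivAlong_of_leibniz [FiniteDimensional ℝ E] [T2Space M] [ContMDiffVectorBundle ∞ F V I]
    [Nontrivial F] {b : Cₛ^∞⟮I; F, V⟯ → Cₛ^∞⟮I; F, V⟯ →ₗ[ℝ] Cₛ^∞⟮I; F, V⟯}
    {ρ : Cₛ^∞⟮I; F, V⟯ → SmoothVectorField I M}
    (b_jacobi : ∀ A B C, b A (b B C) = b (b A B) C + b B (b A C))
    (b_smul : ∀ A f B, b A (smulSection f B) =
      smulSection f (b A B) + smulSection (derivAlong (ρ A) f) B)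
    (A B : Cₛ^∞⟮I; F, V⟯) (f : C^∞⟮I, M; 𝓘(ℝ, ℝ), ℝ⟯) :
    derivAlong (ρ (b A B)) f =
      derivAlong (ρ A) (derivAlong (ρ B) f) - derivAlong (ρ B) (derivAlong (ρ A) f) := by
  ext x
  have : Nontrivial (V x) := ((trivializationAt F V x).continuousLinearEquivAt ℝ x
    (FiberBundle.mem_baseSet_trivializationAt' x)).toEquiv.nontrivial
  obtain ⟨v, hv⟩ := exists_ne (0 : V x)
  obtain ⟨C, rfl⟩ := exists_contMDiffSection_apply_eq (I := I) (F := F) v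
  have h := congrArg (fun S => S x) (smulSection_derivAlong_of_leibniz b_jacobi b_smul A B C f)
  refine smul_left_injective ℝ hv (h.trans ?_)
  exact (sub_smul _ _ _).symm

theorem SmoothVectorField.derivAlong_lie [FiniteDimensional ℝ E] [CompleteSpace E] [T2Space M]
    [Nontrivial E] (X Y : SmoothVectorField I M) (f : C^∞⟮I, M; 𝓘(ℝ, ℝ), ℝ⟯) :
    derivAlong ⁅X, Y⁆ f = derivAlong X (derivAlong Y f) - derivAlong Y (derivAlong X f) :=
  derivAlong_of_leibniz (b := LieModule.toEnd ℝ (SmoothVectorField I M) (SmoothVectorField I M))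
    (ρ := id) leibniz_lie lie_smulSection X Y f

namespace LieAlgebroid

variable (A : LieAlgebroid I F V)

theorem bracket_skew (X Y : Cₛ^∞⟮I; F, V⟯) : A.bracket X Y = -A.bracket Y X :=
  (LinearMap.IsAlt.neg A.bracket_self Y X).symm

theorem bracket_bracket (X Y Z : Cₛ^∞⟮I; F, V⟯) :
    A.bracket X (A.bracket Y Z) = A.bracket (A.bracket X Y) Z + A.bracket Y (A.bracket X Z) := by
  have h := A.jacobi X Y Z
  rw [A.bracket_skew Z X, A.bracket_skew Z, map_neg] at h
  rw [← sub_eq_zero, ← h]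
  abel

theorem bracket_smulSection (X : Cₛ^∞⟮I; F, V⟯) (f : C^∞⟮I, M; 𝓘(ℝ, ℝ), ℝ⟯) (Y : Cₛ^∞⟮I; F, V⟯) :
    A.bracket X (smulSection f Y) =
      smulSection f (A.bracket X Y) + smulSection (derivAlong (mapSection A.anchor X) f) Y := by
  ext x
  exact A.leibniz f X Y x

theorem mapSection_anchor_bracket [FiniteDimensional ℝ E] [CompleteSpace E] [T2Space M]
    [ContMDiffVectorBundle ∞ F V I] (X Y : Cₛ^∞⟮I; F, V⟯) :
    mapSection A.anchor (A.bracket X Y) = ⁅mapSection A.anchor X, mapSection A.anchor Y⁆ := by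
  rcases subsingleton_or_nontrivial E with _ | _
  · have := subsingleton_section_of_subsingleton_fiber (I := I) (F := E)
      (V := fun x : M => TangentSpace I x)
    exact Subsingleton.elim _ _
  rcases subsingleton_or_nontrivial F with _ | _
  · have := subsingleton_section_of_subsingleton_fiber (I := I) (F := F) (V := V)
    rw [Subsingleton.elim X 0, map_zero, LinearMap.zero_apply, map_zero, zero_lie]
  refine SmoothVectorField.ext_derivAlong fun f => ?_
  rw [SmoothVectorField.derivAlong_lie]
  exact derivAlong_of_leibniz (b := A.bracket) (ρ := mapSection A.anchor) A.bracket_bracket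
    A.bracket_smulSection X Y f

end LieAlgebroid

end Anchor

section Nijenhuis

theorem nijenhuisTorsion_eq (K : (x : M) → TangentSpace I x →L[ℝ] TangentSpace I x)
    (X Y : (x : M) → TangentSpace I x) (x : M) :
    nijenhuisTorsion I K X Y x = mlieBracket I (fun y => K y (X y)) (fun y => K y (Y y)) x
      - K x (contractedBracket I K X Y x) := by
  simp only [nijenhuisTorsion, contractedBracket, map_add, map_sub]
  abel

variable [IsManifold I ∞ M] [CompleteSpace E]

theorem contractedLie_smulSection (K : SmoothEndomorphism I M) (X : SmoothVectorField I M)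
    (f : C^∞⟮I, M; 𝓘(ℝ, ℝ), ℝ⟯) (Y : SmoothVectorField I M) :
    contractedLie (mapSection K) X (smulSection f Y) =
      smulSection f (contractedLie (mapSection K) X Y)
        + smulSection (derivAlong (mapSection K X) f) Y := by
  simp only [contractedLie_apply, mapSection_smulSection, SmoothVectorField.lie_smulSection,
    map_add, smulSection_add, smulSection_sub]
  abel

theorem nijenhuisTorsion_eq_zero_iff (K : SmoothEndomorphism I M) (X Y : SmoothVectorField I M) :
    nijenhuisTorsion I K X Y = 0 ↔
      mapSection K (contractedLie (mapSection K) X Y) = ⁅mapSection K X, mapSection K Y⁆ := by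
  rw [funext_iff, ContMDiffSection.ext_iff]
  refine forall_congr' fun x => ?_
  rw [nijenhuisTorsion_eq]
  exact sub_eq_zero.trans eq_comm

/-- The Lie algebroid structure on `TM` with anchor `K` and bracket `[·, ·]_K`, for an endomorphism
`K` with vanishing Nijenhuis torsion. -/
def LieAlgebroid.ofNijenhuis (K : SmoothEndomorphism I M)
    (hK : ∀ X Y : SmoothVectorField I M, nijenhuisTorsion I K X Y = 0) :
    LieAlgebroid I E (fun x : M => TangentSpace I x) where
  anchor := K
  bracket := contractedLie (mapSection K)
  bracket_self := contractedLie_self (mapSection K)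
  jacobi := contractedLie_jacobi fun X Y => (nijenhuisTorsion_eq_zero_iff K X Y).1 (hK X Y)
  leibniz f X Y x := congrArg (fun S => S x) (contractedLie_smulSection K X f Y)

theorem LieAlgebroid.nijenhuisTorsion_anchor_eq_zero [FiniteDimensional ℝ E] [T2Space M]
    (A : LieAlgebroid I E (fun x : M => TangentSpace I x))
    (hA : ∀ X Y, ⇑(A.bracket X Y) = contractedBracket I A.anchor X Y)
    (X Y : SmoothVectorField I M) : nijenhuisTorsion I A.anchor X Y = 0 := by
  have hb : A.bracket X Y = contractedLie (mapSection A.anchor) X Y :=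
    DFunLike.coe_injective (hA X Y)
  rw [nijenhuisTorsion_eq_zero_iff, ← hb, A.mapSection_anchor_bracket]

end Nijenhuis

section Cartan

/-- The expression of a vector field in the preferred chart around `x₀`, that is its pullback by
the inverse of that chart: the counterpart of `DiffForm.inChart` for vector fields. -/
def chartField (X : (x : M) → TangentSpace I x) (x₀ : M) : E → E :=
  mpullbackWithin 𝓘(ℝ, E) I (extChartAt I x₀).symm X (range I)

section ChartField

variable {X : (x : M) → TangentSpace I x} {x : M}

theorem inverse_mfderiv_extChartAt_self_apply [IsManifold I 1 M] (x : M) (v : E) :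
    (mfderiv I 𝓘(ℝ, E) (extChartAt I x) x).inverse v = v :=
  (congrArg (fun L : E →L[ℝ] E => L.inverse v) mfderiv_extChartAt_self).trans
    (congrArg (fun L : E →L[ℝ] E => L v) ContinuousLinearMap.inverse_id)

theorem chartField_extChartAt_self [IsManifold I 1 M] (X : (x : M) → TangentSpace I x) (x : M) :
    chartField X x (extChartAt I x x) = X x := by
  have h := eventuallyEq_mpullback_mpullbackWithin_extChartAt (s := univ) (x := x) X
  rw [nhdsWithin_univ] at h
  rw [h.self_of_nhds, mpullback_apply]
  exact (inverse_mfderiv_extChartAt_self_apply x _).symm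

theorem mlieBracket_eq_lieBracketWithin_chartField [IsManifold I 1 M]
    (X Y : (x : M) → TangentSpace I x) (x : M) :
    mlieBracket I X Y x =
      lieBracketWithin ℝ (chartField X x) (chartField Y x) (range I) (extChartAt I x x) := by
  rw [← mlieBracketWithin_univ, mlieBracketWithin_apply, preimage_univ, univ_inter]
  exact inverse_mfderiv_extChartAt_self_apply x _

theorem differentiableWithinAt_chartField [CompleteSpace E] [IsManifold I 2 M]
    (hX : MDiffAt (T% X) x) :
    DifferentiableWithinAt ℝ (chartField X x) (range I) (extChartAt I x x) := by
  have h := (mdifferentiableWithinAt_univ.2 hX).differentiableWithinAt_mpullbackWithin_vectorField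
  rwa [preimage_univ, univ_inter] at h

end ChartField

namespace DiffForm

/-- A form is differentiable at `x` if its expression in the preferred chart around `x` is. -/
def IsDifferentiableAt {p : ℕ} (η : DiffForm I M p) (x : M) : Prop :=
  DifferentiableWithinAt ℝ (η.inChart x) (range I) (extChartAt I x x)

theorem IsSmooth.isDifferentiableAt {p : ℕ} {η : DiffForm I M p} (hη : η.IsSmooth) (x : M) :
    η.IsDifferentiableAt x :=
  (((hη x).differentiableOn (by simp)) _ (mem_extChartAt_target x)).mono_of_mem_nhdsWithin
    (extChartAt_target_mem_nhdsWithin x)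

variable {p : ℕ}

section ChartExpression

variable [IsManifold I 1 M]

theorem inChart_extChartAt_self (η : DiffForm I M p) (x : M) :
    η.inChart x (extChartAt I x x) = η x := by
  have transport : ∀ {z : M} (_ : z = x) (L : E →L[ℝ] TangentSpace I z),
      (L : E →L[ℝ] E) = .id ℝ E → (η z).compContinuousLinearMap L = η x := by
    rintro z rfl L rfl
    rfl
  exact transport (extChartAt_to_inv x) _ mfderivWithin_range_extChartAt_symm

theorem extDeriv_eq_extDerivWithin (η : DiffForm I M p) (x : M) :
    η.extDeriv x = extDerivWithin (η.inChart x) (range I) (extChartAt I x x) := by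
  rw [extDeriv, mfderiv_extChartAt_self]
  rfl

theorem inChart_apply_chartField (η : DiffForm I M p) {x₀ : M} {y : E}
    (hy : y ∈ (extChartAt I x₀).target) (X : Fin p → (x : M) → TangentSpace I x) :
    η.inChart x₀ y (fun i => chartField (X i) x₀ y) =
      η ((extChartAt I x₀).symm y) fun i => X i ((extChartAt I x₀).symm y) :=
  congrArg (η ((extChartAt I x₀).symm y)) <| funext fun i =>
    (isInvertible_mfderivWithin_extChartAt_symm hy).self_apply_inverse (X i _)

theorem inChart_apply_chartField_eventuallyEq (η : DiffForm I M p) (x : M)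
    (X : Fin p → (x : M) → TangentSpace I x) :
    (fun y => η y fun i => X i y) ∘ (extChartAt I x).symm =ᶠ[𝓝[range I] (extChartAt I x x)]
      fun y => η.inChart x y fun i => chartField (X i) x y := by
  filter_upwards [extChartAt_target_mem_nhdsWithin x] with y hy
  exact (η.inChart_apply_chartField hy X).symm

theorem extDeriv_ofFun {f : M → ℝ} {x : M} (hf : MDiffAt f x) (v : TangentSpace I x) :
    (ofFun f).extDeriv x ![v] = dirDeriv I f x v := by
  rw [extDeriv_eq_extDerivWithin, dirDeriv, hf.mfderiv]
  have hu : UniqueDiffWithinAt ℝ (range I) (extChartAt I x x) := I.uniqueDiffWithinAt_image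
  exact congrArg (fun β => β ![v])
    (extDerivWithin_constOfIsEmpty (f ∘ (extChartAt I x).symm) hu)

end ChartExpression

section CartanFormula

variable [CompleteSpace E] [IsManifold I 2 M]

theorem IsDifferentiableAt.mdifferentiableAt_apply {η : DiffForm I M p} {x : M}
    (hη : η.IsDifferentiableAt x)
    {X : Fin p → (x : M) → TangentSpace I x} (hX : ∀ i, MDiffAt (T% (X i)) x) :
    MDiffAt (fun y => η y fun i => X i y) x := by
  rw [mdifferentiableAt_iff_source_of_mem_source (mem_chart_source H x),
    mdifferentiableWithinAt_iff_differentiableWithinAt]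
  have heq := η.inChart_apply_chartField_eventuallyEq x X
  exact (hη.continuousAlternatingMap_apply fun i => differentiableWithinAt_chartField (hX i))
    |>.congr_of_eventuallyEq heq (heq.eq_of_nhdsWithin (mem_range_self _))

theorem IsDifferentiableAt.mdifferentiableAt_apply_one {α : DiffForm I M 1} {x : M}
    (hα : α.IsDifferentiableAt x) {X : (x : M) → TangentSpace I x} (hX : MDiffAt (T% X) x) :
    MDiffAt (fun y => α y ![X y]) x := by
  simp only [Matrix.vec_single_eq_const]
  exact hα.mdifferentiableAt_apply fun _ => hX

theorem IsDifferentiableAt.dirDeriv_apply {η : DiffForm I M p} {x : M}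
    (hη : η.IsDifferentiableAt x)
    {X : Fin p → (x : M) → TangentSpace I x} (hX : ∀ i, MDiffAt (T% (X i)) x)
    (v : TangentSpace I x) :
    dirDeriv I (fun y => η y fun i => X i y) x v =
      fderivWithin ℝ (fun y => η.inChart x y fun i => chartField (X i) x y) (range I)
        (extChartAt I x x) v := by
  have heq := η.inChart_apply_chartField_eventuallyEq x X
  rw [dirDeriv, (hη.mdifferentiableAt_apply hX).mfderiv]
  exact congrArg (fun L : E →L[ℝ] ℝ => L v)
    (heq.fderivWithin_eq (heq.eq_of_nhdsWithin (mem_range_self _)))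

theorem IsDifferentiableAt.extDeriv_apply {η : DiffForm I M (p + 1)} {x : M}
    (hη : η.IsDifferentiableAt x)
    {X : Fin (p + 2) → (x : M) → TangentSpace I x} (hX : ∀ i, MDiffAt (T% (X i)) x) :
    η.extDeriv x (fun i => X i x) =
      (∑ i, (-1) ^ i.val •
        dirDeriv I (fun y => η y (i.removeNth fun j => X j y)) x (X i x)) -
      ∑ i : Fin (p + 1), ∑ j ≥ i, (-1) ^ (i + j : ℕ) •
        η x (Matrix.vecCons (mlieBracket I (X i.castSucc) (X j.succ) x)
          (j.removeNth <| i.castSucc.removeNth fun k => X k x)) := by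
  have hchart := extDerivWithin_apply_vectorField hη
    (fun i => differentiableWithinAt_chartField (hX i)) (I.uniqueDiffWithinAt_image)
  have hself : (fun i => chartField (X i) x (extChartAt I x x)) = fun i => X i x :=
    funext fun i => chartField_extChartAt_self (X i) x
  rw [extDeriv_eq_extDerivWithin]
  refine (congrArg _ hself.symm).trans (hchart.trans (congrArg₂ _ ?_ ?_))
  · refine Finset.sum_congr rfl fun i _ => congrArg _ ?_
    rw [chartField_extChartAt_self]
    exact (hη.dirDeriv_apply (fun j => hX (i.succAbove j)) _).symm
  · refine Finset.sum_congr rfl fun i _ => Finset.sum_congr rfl fun j _ => congrArg _ ?_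
    rw [mlieBracket_eq_lieBracketWithin_chartField, hself, inChart_extChartAt_self]
    rfl

theorem IsDifferentiableAt.extDeriv_apply_two {α : DiffForm I M 1} {x : M}
    (hα : α.IsDifferentiableAt x)
    {X Y : (x : M) → TangentSpace I x} (hX : MDiffAt (T% X) x) (hY : MDiffAt (T% Y) x) :
    α.extDeriv x ![X x, Y x] =
      dirDeriv I (fun y => α y ![Y y]) x (X x) - dirDeriv I (fun y => α y ![X y]) x (Y x)
        - α x ![mlieBracket I X Y x] := by
  let Z : Fin 2 → (x : M) → TangentSpace I x := ![X, Y]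
  have hZ : ∀ i, MDiffAt (T% (Z i)) x := Fin.forall_fin_two.2 ⟨hX, hY⟩
  have h₀₁ : (fun i => Z i x) = ![X x, Y x] := funext fun i => by fin_cases i <;> rfl
  have h₀ : ∀ y, (Fin.removeNth 0 fun i => Z i y) = ![Y y] := fun y =>
    funext fun i => by fin_cases i; rfl
  have h₁ : ∀ y, (Fin.removeNth 1 fun i => Z i y) = ![X y] := fun y =>
    funext fun i => by fin_cases i; rfl
  have h := hα.extDeriv_apply hZ
  rw [Fin.sum_univ_two] at h
  simp only [h₀, h₁, h₀₁] at h
  simpa [Z, ← sub_eq_add_neg] using h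

end CartanFormula

end DiffForm

end Cartan

section LieDerivative

theorem differentiableWithinAt_of_forall_clm_apply {D F G : Type*} [NormedAddCommGroup D]
    [NormedSpace ℝ D] [NormedAddCommGroup F] [NormedSpace ℝ F] [NormedAddCommGroup G]
    [NormedSpace ℝ G] [FiniteDimensional ℝ F] {f : D → F →L[ℝ] G} {s : Set D} {x : D}
    (h : ∀ v, DifferentiableWithinAt ℝ (fun y => f y v) s x) : DifferentiableWithinAt ℝ f s x := by
  let d := Module.finrank ℝ F
  have hd : d = Module.finrank ℝ (Fin d → ℝ) := (Module.finrank_fin_fun ℝ).symm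
  let e₁ := ContinuousLinearEquiv.ofFinrankEq hd
  let e₂ := (e₁.arrowCongr (1 : G ≃L[ℝ] G)).trans (ContinuousLinearEquiv.piRing (Fin d))
  rw [← e₂.comp_differentiableWithinAt_iff]
  exact differentiableWithinAt_pi.2 fun i => h _

theorem exists_mdifferentiableAt_chartField_eq [CompleteSpace E] [IsManifold I 2 M] (x : M)
    (v : E) : ∃ W : (y : M) → TangentSpace I y, MDiffAt (T% W) x ∧
      ∀ y ∈ (extChartAt I x).target, chartField W x y = v := by
  refine ⟨mpullback I 𝓘(ℝ, E) (extChartAt I x) fun _ => v, ?_, fun y hy => ?_⟩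
  · refine MDifferentiableAt.mpullback_vectorField (n := 2) ?_
      (contMDiffAt_extChartAt' (mem_chart_source H x))
      (isInvertible_mfderiv_extChartAt (mem_extChartAt_source x)) le_rfl
    exact (contMDiffAt_vectorSpace_iff_contDiffAt.2
      (contDiffAt_const (n := 1) (c := v))).mdifferentiableAt one_ne_zero
  · have hW := (isInvertible_mfderiv_extChartAt (I := I)
      ((extChartAt I x).map_target hy)).inverse_apply_eq.2
        (congrArg (fun L : E →L[ℝ] E => L v)
          (mfderiv_extChartAt_comp_mfderivWithin_extChartAt_symm hy)).symm
    exact (isInvertible_mfderivWithin_extChartAt_symm hy).inverse_apply_eq.2 hW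

namespace DiffForm

theorem isDifferentiableAt_of_forall_apply [FiniteDimensional ℝ E] [IsManifold I 2 M]
    {α : DiffForm I M 1} {x : M}
    (h : ∀ W : (y : M) → TangentSpace I y, MDiffAt (T% W) x → MDiffAt (fun y => α y ![W y]) x) :
    α.IsDifferentiableAt x := by
  have : CompleteSpace E := FiniteDimensional.complete ℝ E
  let e := ContinuousAlternatingMap.ofSubsingletonLIE (𝕜 := ℝ) (E := E) (F := ℝ) (0 : Fin 1)
  refine (e.symm.toContinuousLinearEquiv.comp_differentiableWithinAt_iff).1
    (differentiableWithinAt_of_forall_clm_apply fun v => ?_)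
  obtain ⟨W, hW, hWv⟩ := exists_mdifferentiableAt_chartField_eq (I := I) x v
  have hαW := ((mdifferentiableAt_iff_source_of_mem_source (mem_chart_source H x)).1
    (h W hW)).differentiableWithinAt
  have heq : (fun y => α.inChart x y fun _ => v) =ᶠ[𝓝[range I] (extChartAt I x x)]
      (fun y => α y ![W y]) ∘ (extChartAt I x).symm := by
    filter_upwards [extChartAt_target_mem_nhdsWithin x] with y hy
    have hαy := α.inChart_apply_chartField hy fun _ => W
    simp only [hWv y hy] at hαy
    simpa only [Function.comp_apply, Matrix.vec_single_eq_const] using hαy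
  exact hαW.congr_of_eventuallyEq heq (heq.eq_of_nhdsWithin (mem_range_self _))

theorem insertion_one_apply (K : (x : M) → TangentSpace I x →L[ℝ] TangentSpace I x)
    (α : DiffForm I M 1) (x : M) (v : TangentSpace I x) :
    insertion K α x ![v] = α x ![K x v] := by
  rw [insertion, insertEndomorphism_apply, Fin.sum_univ_one]
  congr 1
  funext i
  fin_cases i
  simp

theorem insertion_two_apply (K : (x : M) → TangentSpace I x →L[ℝ] TangentSpace I x)
    (β : DiffForm I M 2) (x : M) (v w : TangentSpace I x) :
    insertion K β x ![v, w] = β x ![K x v, w] + β x ![v, K x w] := by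
  rw [insertion, insertEndomorphism_apply, Fin.sum_univ_two]
  congr 2 <;>
  · funext i
    fin_cases i <;> simp

theorem insertion_ofFun (K : (x : M) → TangentSpace I x →L[ℝ] TangentSpace I x) (f : M → ℝ) :
    insertion K (ofFun (I := I) f) = ofFun 0 := by
  ext x
  simp [insertion, insertEndomorphism_apply, ofFun]

theorem lieDeriv_ofFun [IsManifold I 1 M]
    (K : (x : M) → TangentSpace I x →L[ℝ] TangentSpace I x) {f : M → ℝ} {x : M}
    (hf : MDiffAt f x) (v : TangentSpace I x) :
    lieDeriv K 0 (ofFun f) x ![v] = dirDeriv I f x (K x v) := by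
  have hd : (ofFun (I := I) (0 : M → ℝ)).extDeriv x ![v] = 0 := by
    rw [extDeriv_ofFun (f := 0) mdifferentiableAt_const, dirDeriv]
    exact congrArg (fun L : E →L[ℝ] ℝ => L v) mfderiv_const
  calc lieDeriv K 0 (ofFun f) x ![v]
      = insertion K (ofFun f).extDeriv x ![v] - (insertion K (ofFun f)).extDeriv x ![v] := rfl
    _ = dirDeriv I f x (K x v) := by
      rw [insertion_one_apply, extDeriv_ofFun hf, insertion_ofFun, hd, sub_zero]

section Endomorphism

variable [FiniteDimensional ℝ E] [IsManifold I 2 M]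
  {K : (x : M) → TangentSpace I x →L[ℝ] TangentSpace I x} {α : DiffForm I M 1} {x : M}

theorem IsDifferentiableAt.insertion (hα : α.IsDifferentiableAt x)
    (hK : MDiffAt (fun y => Bundle.TotalSpace.mk' (E →L[ℝ] E)
      (E := fun y : M => TangentSpace I y →L[ℝ] TangentSpace I y) y (K y)) x) :
    (DiffForm.insertion K α).IsDifferentiableAt x := by
  have : CompleteSpace E := FiniteDimensional.complete ℝ E
  refine isDifferentiableAt_of_forall_apply fun W hW => ?_
  simp only [insertion_one_apply]
  exact hα.mdifferentiableAt_apply_one (hK.clm_bundle_apply hW)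

theorem apply_contractedBracket (hα : α.IsDifferentiableAt x)
    (hK : MDiffAt (fun y => Bundle.TotalSpace.mk' (E →L[ℝ] E)
      (E := fun y : M => TangentSpace I y →L[ℝ] TangentSpace I y) y (K y)) x)
    {X Y : (x : M) → TangentSpace I x} (hX : MDiffAt (T% X) x) (hY : MDiffAt (T% Y) x) :
    α x ![contractedBracket I K X Y x] =
      lieDeriv K 0 (ofFun fun y => α y ![Y y]) x ![X x]
      - lieDeriv K 0 (ofFun fun y => α y ![X y]) x ![Y x] - lieDeriv K 1 α x ![X x, Y x] := by
  have : CompleteSpace E := FiniteDimensional.complete ℝ E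
  have hKX : MDiffAt (T% fun y => K y (X y)) x := hK.clm_bundle_apply hX
  have hKY : MDiffAt (T% fun y => K y (Y y)) x := hK.clm_bundle_apply hY
  have hadd (u v : TangentSpace I x) : α x ![u + v] = α x ![u] + α x ![v] :=
    (α x).vecCons_add ![] u v
  have hsub (u v : TangentSpace I x) : α x ![u - v] = α x ![u] - α x ![v] := by
    rw [eq_sub_iff_add_eq, ← hadd, sub_add_cancel]
  have hLie : lieDeriv K 1 α x ![X x, Y x] =
      insertion K α.extDeriv x ![X x, Y x] - (insertion K α).extDeriv x ![X x, Y x] := rfl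
  rw [lieDeriv_ofFun K (hα.mdifferentiableAt_apply_one hX),
    lieDeriv_ofFun K (hα.mdifferentiableAt_apply_one hY), hLie, insertion_two_apply,
    hα.extDeriv_apply_two hKX hY, hα.extDeriv_apply_two hX hKY,
    (hα.insertion hK).extDeriv_apply_two hX hY, contractedBracket, hsub, hadd]
  simp only [insertion_one_apply]
  ring

end Endomorphism

variable (I) in
/-- The differential `df` of a function `f` on `M`, as a `1`-form. For a smooth `f` it is the
exterior derivative of `ofFun f`. -/
def differential (f : M → ℝ) : DiffForm I M 1 := fun x =>
  ContinuousAlternatingMap.ofSubsingleton ℝ (TangentSpace I x) ℝ (0 : Fin 1)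
    (mfderiv I 𝓘(ℝ, ℝ) f x : TangentSpace I x →L[ℝ] ℝ)

theorem differential_apply (f : M → ℝ) (x : M) (v : TangentSpace I x) :
    differential I f x ![v] = dirDeriv I f x v := rfl

theorem inChart_differential [IsManifold I 1 M] {f : M → ℝ} {x₀ : M} {y : E}
    (hy : y ∈ (extChartAt I x₀).target) (hf : MDiffAt f ((extChartAt I x₀).symm y)) :
    (differential I f).inChart x₀ y = ContinuousAlternatingMap.ofSubsingleton ℝ E ℝ (0 : Fin 1)
      (fderivWithin ℝ (f ∘ (extChartAt I x₀).symm) (extChartAt I x₀).target y) := by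
  have h := mfderiv_comp_mfderivWithin (I'' := 𝓘(ℝ, ℝ)) y hf
    (mdifferentiableWithinAt_extChartAt_symm hy)
    (I.uniqueDiffOn.uniqueMDiffOn _ (extChartAt_target_subset_range x₀ hy))
  rw [mfderivWithin_eq_fderivWithin] at h
  rw [fderivWithin_congr_set (extChartAt_target_eventuallyEq_of_mem hy), h]
  rfl

theorem isSmooth_differential [IsManifold I ∞ M] {f : M → ℝ} (hf : CMDiff ∞ f) :
    (differential I f).IsSmooth := by
  intro x₀
  have hc : ContDiffOn ℝ ∞ (f ∘ (extChartAt I x₀).symm) (extChartAt I x₀).target :=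
    (hf.comp_contMDiffOn (contMDiffOn_extChartAt_symm x₀)).contDiffOn
  let e := ContinuousAlternatingMap.ofSubsingletonLIE (𝕜 := ℝ) (E := E) (F := ℝ) (0 : Fin 1)
  exact (e.contDiff.comp_contDiffOn
    (hc.fderivWithin (uniqueDiffOn_extChartAt_target x₀) (m := ∞) (by simp))).congr
      fun y hy => inChart_differential hy (hf.mdifferentiable (by simp) _)

end DiffForm

end LieDerivative

section Induced

variable [FiniteDimensional ℝ E] [IsManifold I ∞ M] {K : SmoothEndomorphism I M}
  {A : LieAlgebroid I E (fun x : M => TangentSpace I x)}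

theorem LieAlgebroid.isInducedBy_lieDeriv (hanchor : A.anchor = K)
    (hbracket : ∀ X Y, ⇑(A.bracket X Y) = contractedBracket I K X Y) :
    A.IsInducedBy (DiffForm.lieDeriv K) where
  anchor_eq f X x := by
    rw [DiffForm.lieDeriv_ofFun _ f.mdifferentiableAt, hanchor]
  bracket_eq α hα X Y x := by
    rw [hbracket]
    exact DiffForm.apply_contractedBracket (hα.isDifferentiableAt x)
      K.mdifferentiableAt X.mdifferentiableAt Y.mdifferentiableAt

theorem LieAlgebroid.IsInducedBy.anchor_eq_and_bracket_eq [T2Space M]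
    (hA : A.IsInducedBy (DiffForm.lieDeriv K)) :
    A.anchor = K ∧ ∀ X Y, ⇑(A.bracket X Y) = contractedBracket I K X Y := by
  constructor
  · ext1 x
    refine ContinuousLinearMap.ext fun v => eq_of_forall_dirDeriv_eq fun f => ?_
    obtain ⟨X, rfl⟩ := exists_contMDiffSection_apply_eq (I := I) (F := E)
      (V := fun x : M => TangentSpace I x) v
    rw [hA.anchor_eq, DiffForm.lieDeriv_ofFun _ f.mdifferentiableAt]
  · intro X Y
    funext x
    refine eq_of_forall_dirDeriv_eq fun f => ?_
    have hdf := DiffForm.isSmooth_differential (I := I) f.contMDiff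
    rw [← DiffForm.differential_apply, ← DiffForm.differential_apply, hA.bracket_eq _ hdf,
      DiffForm.apply_contractedBracket (hdf.isDifferentiableAt x)
        K.mdifferentiableAt X.mdifferentiableAt Y.mdifferentiableAt]

end Induced

end

theorem mainTheorem8_general {E : Type*} [NormedAddCommGroup E] [NormedSpace ℝ E]
    [FiniteDimensional ℝ E] {H : Type*} [TopologicalSpace H] (I : ModelWithCorners ℝ E H)
    {M : Type*} [TopologicalSpace M] [ChartedSpace H M] [IsManifold I ∞ M] [T2Space M]
    (K : Cₛ^∞⟮I; E →L[ℝ] E, fun x : M => TangentSpace I x →L[ℝ] TangentSpace I x⟯) :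
    ((∃ A : LieAlgebroid I E (fun x : M => TangentSpace I x),
        A.IsInducedBy (DiffForm.lieDeriv K) ∧ A.anchor = K ∧
        ∀ X Y, ⇑(A.bracket X Y) = contractedBracket I K X Y) ↔
      ∀ X Y : Cₛ^∞⟮I; E, fun x : M => TangentSpace I x⟯, nijenhuisTorsion I K X Y = 0) ∧
    ∀ A : LieAlgebroid I E (fun x : M => TangentSpace I x),
      A.IsInducedBy (DiffForm.lieDeriv K) →
        A.anchor = K ∧ ∀ X Y, ⇑(A.bracket X Y) = contractedBracket I K X Y := by
  have : CompleteSpace E := FiniteDimensional.complete ℝ E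
  refine ⟨⟨?_, fun hK => ?_⟩, fun A hA => hA.anchor_eq_and_bracket_eq⟩
  · rintro ⟨A, -, rfl, hA⟩
    exact A.nijenhuisTorsion_anchor_eq_zero hA
  · have hbracket X Y :
        ⇑((LieAlgebroid.ofNijenhuis K hK).bracket X Y) = contractedBracket I K X Y := rfl
    exact ⟨.ofNijenhuis K hK, LieAlgebroid.isInducedBy_lieDeriv rfl hbracket, rfl, hbracket⟩

theorem mainTheorem8 {E : Type*} [NormedAddCommGroup E] [NormedSpace ℝ E] [FiniteDimensional ℝ E]
    {H : Type*} [TopologicalSpace H] (I : ModelWithCorners ℝ E H)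
    {M : Type*} [TopologicalSpace M] [ChartedSpace H M] [IsManifold I ∞ M]
    [BoundarylessManifold I M] [T2Space M]
    (K : Cₛ^∞⟮I; E →L[ℝ] E, fun x : M => TangentSpace I x →L[ℝ] TangentSpace I x⟯) :
    ((∃ A : LieAlgebroid I E (fun x : M => TangentSpace I x),
        A.IsInducedBy (DiffForm.lieDeriv K) ∧ A.anchor = K ∧
        ∀ X Y, ⇑(A.bracket X Y) = contractedBracket I K X Y) ↔
      ∀ X Y : Cₛ^∞⟮I; E, fun x : M => TangentSpace I x⟯, nijenhuisTorsion I K X Y = 0) ∧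
    ∀ A : LieAlgebroid I E (fun x : M => TangentSpace I x),
      A.IsInducedBy (DiffForm.lieDeriv K) →
        A.anchor = K ∧ ∀ X Y, ⇑(A.bracket X Y) = contractedBracket I K X Y :=
  mainTheorem8_general I K
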